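/- Let $n\ge 2$. For $S\subseteq[n]=\{1,\dots,n\}$ let $\delta(S)\in\{0,1\}^{\binom n2}$ be the cut vector of $K_n$, with $\delta(S)_{ij}=1$ iff exactly one of $i,j$ lies in $S$ ($1\le i<j\le n$), and let $\mathrm{CUT}^\square_n=\mathrm{conv}\{\delta(S):S\subseteq[n]\}$. For $b\in\mathbb Z^n$ consider the inequality $$(\ast)_b\qquad \sum_{1\le i<j\le n}b_ib_jx_{ij}\le\Big\lfloor\tfrac14\Big(\sum_{i=1}^n b_i\Big)^2\Big\rfloor ,$$ called hypermetric (resp. of negative type) if the $b_i$ can be partitioned into two parts whose sums differ by $1$ (resp. by $0$); the slack of $x$ is the right side minus the left side. The hypermetric polytope $\mathrm{HYP}^\square_n$ is the set of all $x\in\mathbb R^{\binom n2}$ that satisfy all hypermetric inequalities. Let $M^*(k)$ be the $2^k\times2^k$ matrix with rows and columns indexed by $a,b\in\{0,1\}^k$ and entries $M^*_{ab}=(a^{\top}b-1)^2$. A slack matrix of $P$ is a matrix $(\beta_i-A_iv_j)_{ij}$ where $P=\{x: A_ix\le \beta_i\ \forall i\}=\mathrm{conv}\{v_j\}$ (redundant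 inequalities and non-vertices $v_j$ are allowed). The extension complexity $\mathrm{xc}(P)$ is the minimum number of facets of a polytope $Q\subseteq\mathbb R^e$ that has $P$ as its image under a linear map; an extended formulation of $P$ of size $r$ is a system $Ex+Fy=g$, $y\ge0$, $y\in\mathbb R^r$, such that $x\in P$ iff some $y$ satisfies it together with $x$. 1. For $b=(1,\dots,1,3-n)$, the inequality $(\ast)_b$ is of negative type and reads $\sum_{1\le i<j\le n-1}x_{ij}\le 1+(n-3)\sum_{i=1}^{n-1}x_{in}$, and for every $S\subseteq[n]$ with $n\notin S$ the slack of $\delta(S)$ is $(|S|-1)^2$. 2. For $T\subseteq[n-1]$ let $b^T_i=1$ for $i\in T$, $b^T_i=0$ for $i\in[n-1]\setminus T$, and $b^T_n=2-|T|$. The inequality $(\ast)_{b^T}$ is valid for $\mathrm{CUT}^\square_n$ and for $\mathrm{HYP}^\square_n$, it is of negative type if $T\neq\emptyset$ (for $T=\emptyset$ it reads $0\le1$), and for every $S\subseteq[n-1]$ the slack of $\delta(S)$ is $(|S\cap T|-1)^2$. 3. $\mathrm{CUT}^\square_n\subseteq\mathrm{HYP}^\square_n$, and every inequality of negative type is valid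 for $\mathrm{HYP}^\square_n$. 4. $M^*(n-1)$ is a submatrix of a finite slack matrix of $\mathrm{CUT}^\square_n$. 5. Every slack matrix of $\mathrm{HYP}^\square_n$ (with finite or infinite index sets) becomes, by adding $2^{n-1}$ rows and $2^{n-1}$ columns, a slack matrix of $\mathrm{HYP}^\square_n$ whose new rows and columns form the submatrix $M^*(n-1)$; and there is a slack matrix of $\mathrm{HYP}^\square_n$ (possibly with infinite index sets) that contains $M^*(n-1)$ as a submatrix. 6. Consequently every extended formulation of $\mathrm{CUT}^\square_n$ and every extended formulation of $\mathrm{HYP}^\square_n$ has size $2^{\Omega(n)}$, and $\mathrm{xc}(\mathrm{CUT}^\square_n)=2^{\Omega(n)}$, $\mathrm{xc}(\mathrm{HYP}^\square_n)=2^{\Omega(n)}$: there are $c>0$ and $N$ such that all these quantities are at least $2^{cn}$ for all $n\ge N$. -/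

import Mathlib

open scoped ENNReal Matrix

noncomputable section

namespace CutXC

/-! ### Cuts, the cut polytope and the hypermetric polytope

The vertices of `K_n` are the elements of `Fin n`; its edges `ij` are listed with `i < j`. -/

/-- The edges `ij`, `i < j`, of the complete graph `K_n`. -/
abbrev Edge (n : ℕ) : Type := {p : Fin n × Fin n // p.1 < p.2}

/-- The cut vector `δ(S)`: its `ij`-coordinate is `1` if exactly one of `i`, `j` lies in `S`,
and `0` otherwise. -/
def cutVector {n : ℕ} (S : Finset (Fin n)) : Edge n → ℝ :=
  fun e => if (e.1.1 ∈ S ↔ e.1.2 ∈ S) then 0 else 1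

/-- The cut polytope of `K_n`. -/
def cutPolytope (n : ℕ) : Set (Edge n → ℝ) :=
  convexHull ℝ (Set.range fun S : Finset (Fin n) => cutVector S)

/-- The slack (right-hand side minus left-hand side) at `x` of the inequality
`∑_{i<j} b_i b_j x_ij ≤ ⌊(∑_i b_i)² / 4⌋`. -/
def hypSlack {n : ℕ} (b : Fin n → ℤ) (x : Edge n → ℝ) : ℝ :=
  (⌊((∑ i, b i : ℤ) : ℝ) ^ 2 / 4⌋ : ℝ) - ∑ e : Edge n, (b e.1.1 : ℝ) * (b e.1.2 : ℝ) * x e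

/-- The integers `b_i` can be partitioned into two parts whose sums differ by one. -/
def IsHypermetric {n : ℕ} (b : Fin n → ℤ) : Prop :=
  ∃ A : Finset (Fin n), |∑ i ∈ A, b i - ∑ i ∈ Aᶜ, b i| = 1

/-- The integers `b_i` can be partitioned into two parts with equal sums. -/
def IsNegativeType {n : ℕ} (b : Fin n → ℤ) : Prop :=
  ∃ A : Finset (Fin n), ∑ i ∈ A, b i - ∑ i ∈ Aᶜ, b i = 0

/-- The hypermetric polytope on `n` points: the intersection of all hypermetric inequalities. -/
def hypermetricPolytope (n : ℕ) : Set (Edge n → ℝ) :=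
  {x | ∀ b : Fin n → ℤ, IsHypermetric b → 0 ≤ hypSlack b x}

/-- The vector `b = (1, …, 1, 3 - n)` for `n = m + 1`. -/
def bVec (m : ℕ) : Fin (m + 1) → ℤ :=
  Fin.snoc (α := fun _ => ℤ) (fun _ => 1) (3 - ((m + 1 : ℕ) : ℤ))

/-- For `T ⊆ {1, …, n - 1}`, `n = m + 1`: the vector with `b_i = 1` for `i ∈ T`, `b_i = 0` for the
other `i ≤ n - 1`, and `b_n = 2 - |T|`. -/
def bVecOf {m : ℕ} (T : Finset (Fin m)) : Fin (m + 1) → ℤ :=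
  Fin.snoc (α := fun _ => ℤ) (fun i => if i ∈ T then 1 else 0) (2 - (T.card : ℤ))

/-! ### Slack matrices -/

/-- The matrix `M*(k)`, indexed by `k`-bit strings, with entries `(aᵀ b - 1)²`. -/
def MStar (k : ℕ) : Matrix (Fin k → Fin 2) (Fin k → Fin 2) ℝ :=
  Matrix.of fun a b => (∑ i, ((a i : ℕ) : ℝ) * ((b i : ℕ) : ℝ) - 1) ^ 2

/-- `N` is a submatrix of `M` (up to the naming of its rows and columns). -/
def IsSubmatrix {ι κ ι' κ' : Type*} (N : Matrix ι' κ' ℝ) (M : Matrix ι κ ℝ) : Prop :=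
  ∃ (r : ι' → ι) (c : κ' → κ), Function.Injective r ∧ Function.Injective c ∧ M.submatrix r c = N

/-- `M` is a slack matrix of `P`: there are a system `A x ≤ b` and points `v_j` with
`P = {x | A x ≤ b} = conv {v_j}` and `M_ij = b_i - A_i v_j`. Redundant inequalities and
points that are not vertices are allowed. For an ordinary (finite) slack matrix the index types
`ι` and `κ` are finite; the definition makes sense without this. -/
def IsSlackMatrix {d ι κ : Type*} [Fintype d] (P : Set (d → ℝ)) (M : Matrix ι κ ℝ) : Prop :=
  ∃ (A : Matrix ι d ℝ) (b : ι → ℝ) (v : κ → d → ℝ),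
    P = {x | ∀ i, (A *ᵥ x) i ≤ b i} ∧
    P = convexHull ℝ (Set.range v) ∧
    ∀ i j, M i j = b i - (A *ᵥ v j) i

/-! ### Extension complexity -/

/-- A polytope is the convex hull of a finite set of points. -/
def IsPolytope {d : Type*} [Fintype d] (Q : Set (d → ℝ)) : Prop :=
  ∃ V : Set (d → ℝ), V.Finite ∧ Q = convexHull ℝ V

/-- The facets of `Q`: its nonempty (exposed) faces of dimension `dim Q - 1`. -/
def facets {d : Type*} [Fintype d] (Q : Set (d → ℝ)) : Set (Set (d → ℝ)) :=
  {F | F.Nonempty ∧ IsExposed ℝ Q F ∧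
    Module.finrank ℝ (vectorSpan ℝ F) + 1 = Module.finrank ℝ (vectorSpan ℝ Q)}

/-- The extension complexity of `P`: the least number of facets of a polytope `Q ⊆ ℝ^e` that some
linear map sends onto `P`. -/
def extensionComplexity {d : Type*} [Fintype d] (P : Set (d → ℝ)) : ℕ∞ :=
  ⨅ (e : ℕ) (Q : Set (Fin e → ℝ)) (_ : IsPolytope Q)
    (π : (Fin e → ℝ) →ₗ[ℝ] (d → ℝ)) (_ : π '' Q = P), (facets Q).encard

/-- `P` has an extended formulation `E x + F y = g`, `y ≥ 0` of size `r` (that is, with `r`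
inequalities `y_k ≥ 0`, and any finite number of equations). -/
def HasExtendedFormulation {d : Type*} [Fintype d] (P : Set (d → ℝ)) (r : ℕ) : Prop :=
  ∃ (k : ℕ) (E : Matrix (Fin k) d ℝ) (F : Matrix (Fin k) (Fin r) ℝ) (g : Fin k → ℝ),
    ∀ x : d → ℝ, x ∈ P ↔ ∃ y : Fin r → ℝ, (∀ i, 0 ≤ y i) ∧ E *ᵥ x + F *ᵥ y = g

end CutXC

end

/-! On a cut vector the left side of the inequality factors as b(S)·b(Sᶜ), so when the entries of b
sum to 2 the slack is (b(S) - 1)². The vectors `bVecOf T` thus turn slacks into (|S ∩ T| - 1)²,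
which is `MStar`. They are valid for the hypermetric polytope too, since an inequality of negative
type is the average of the two hypermetric inequalities of b ± e_k. From here on both polytopes are
treated alike: all that is used of P is that it contains the cuts and satisfies the inequalities of
the `bVecOf T`.

The lower bound comes from the zero pattern of `MStar`: slack 0 if |S ∩ T| = 1, slack 1 if S and T
are disjoint. An induction on the ground set (`card_disjoint_pairs_le`) shows that a rectangle
without pairs meeting in one element contains at most 2^k of the 3^k disjoint pairs, so covering
them takes about (3/2)^k rectangles.

A small extension yields a small cover, with one rectangle per inequality y_i ≥ 0
(`HasExtendedFormulation.three_pow_le`) or per facet (`three_pow_le_ncard_facets`). In the first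
case a convexity argument on lifted points replaces a nonnegative factorization of the slack matrix.
In the second, a supporting functional is rotated until its face is a facet that still misses a
given point (`exists_mem_facets`).

A finite slack matrix of the cut polytope needs finitely many rows; these come from Fourier–Motzkin
elimination applied to the cone over the cuts. -/

namespace CutXC

/-! ### Sums over edges and slacks of cut vectors -/

/-- Twice the sum over the edges of a symmetric function that vanishes on the diagonal is its sum
over all ordered pairs. -/
lemma two_mul_sum_edge {n : ℕ} (f : Fin n → Fin n → ℝ) (hsymm : ∀ i j, f i j = f j i)
    (hdiag : ∀ i, f i i = 0) : 2 * ∑ e : Edge n, f e.1.1 e.1.2 = ∑ i, ∑ j, f i j := by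
  have hlt : ∑ e : Edge n, f e.1.1 e.1.2 = ∑ i, ∑ j, if i < j then f i j else 0 := by
    rw [← Finset.sum_product', ← Finset.sum_filter]
    exact (Finset.sum_subtype (p := fun p : Fin n × Fin n => p.1 < p.2) _ (by simp)
      (fun p => f p.1 p.2)).symm
  have hgt : ∑ e : Edge n, f e.1.1 e.1.2 = ∑ i, ∑ j, if j < i then f i j else 0 := by
    rw [hlt, Finset.sum_comm]
    exact Finset.sum_congr rfl fun i _ => Finset.sum_congr rfl fun j _ => by rw [hsymm]
  rw [two_mul]
  nth_rewrite 1 [hlt]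
  rw [hgt]
  simp_rw [← Finset.sum_add_distrib]
  refine Finset.sum_congr rfl fun i _ => Finset.sum_congr rfl fun j _ => ?_
  rcases lt_trichotomy i j with h | rfl | h
  · simp [h, h.not_gt]
  · simp [hdiag]
  · simp [h, h.not_gt]

/-- Only edges between S and its complement contribute, so the sum is a product of two sums; the sum
over ordered pairs counts each such edge twice. -/
lemma sum_mul_cutVector {n : ℕ} (b : Fin n → ℤ) (S : Finset (Fin n)) :
    ∑ e : Edge n, (b e.1.1 : ℝ) * (b e.1.2 : ℝ) * cutVector S e =
      (∑ i ∈ S, (b i : ℝ)) * (∑ i, (b i : ℝ) - ∑ i ∈ S, (b i : ℝ)) := by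
  have h := two_mul_sum_edge
    (fun i j => (b i : ℝ) * (b j : ℝ) * if (i ∈ S ↔ j ∈ S) then 0 else 1)
    (fun i j => by simp only [iff_comm (a := i ∈ S)]; ring) (fun i => by simp)
  have hS : ∑ i ∈ S, (b i : ℝ) = ∑ i, if i ∈ S then (b i : ℝ) else 0 := by simp
  have hsplit : ∑ i, ∑ j, (b i : ℝ) * (b j : ℝ) * (if (i ∈ S ↔ j ∈ S) then (0 : ℝ) else 1) =
      ∑ i, ∑ j, ((if i ∈ S then (b i : ℝ) else 0) * (b j - if j ∈ S then (b j : ℝ) else 0) +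
        (b i - if i ∈ S then (b i : ℝ) else 0) * (if j ∈ S then (b j : ℝ) else 0)) := by
    refine Finset.sum_congr rfl fun i _ => Finset.sum_congr rfl fun j _ => ?_
    by_cases hi : i ∈ S <;> by_cases hj : j ∈ S <;> simp [hi, hj]
  rw [hsplit] at h
  simp_rw [Finset.sum_add_distrib, ← Finset.sum_mul_sum, Finset.sum_sub_distrib, ← hS] at h
  simp only [cutVector]
  linarith

lemma hypSlack_cutVector {n : ℕ} (b : Fin n → ℤ) (S : Finset (Fin n)) :
    hypSlack b (cutVector S) = (⌊((∑ i, b i : ℤ) : ℝ) ^ 2 / 4⌋ : ℝ) -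
      (∑ i ∈ S, (b i : ℝ)) * (∑ i, (b i : ℝ) - ∑ i ∈ S, (b i : ℝ)) := by
  rw [hypSlack, sum_mul_cutVector]

/-- The inequality of `b` is valid for all cut vectors. -/
lemma hypSlack_cutVector_nonneg {n : ℕ} (b : Fin n → ℤ) (S : Finset (Fin n)) :
    0 ≤ hypSlack b (cutVector S) := by
  rw [hypSlack_cutVector, sub_nonneg]
  -- The product s(σ - s) is an integer and at most σ²/4, as (2s - σ)² ≥ 0; hence it is at most the
  -- floor.
  have h : (∑ i ∈ S, b i) * (∑ i, b i - ∑ i ∈ S, b i) ≤ ⌊((∑ i, b i : ℤ) : ℝ) ^ 2 / 4⌋ := by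
    rw [Int.le_floor]
    push_cast
    nlinarith [sq_nonneg (2 * ∑ i ∈ S, (b i : ℝ) - ∑ i, (b i : ℝ))]
  exact_mod_cast h

/-- The right side is 1, and 1 - s(2 - s) = (s - 1)². -/
lemma hypSlack_cutVector_of_sum_eq_two {n : ℕ} {b : Fin n → ℤ} (hb : ∑ i, b i = 2)
    (S : Finset (Fin n)) : hypSlack b (cutVector S) = (∑ i ∈ S, (b i : ℝ) - 1) ^ 2 := by
  have hb' : ∑ i, (b i : ℝ) = 2 := by exact_mod_cast hb
  rw [hypSlack_cutVector, hb, hb']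
  norm_num
  ring

/-- The left-hand side of the inequality of `b`, as a linear form. -/
noncomputable def hypForm {n : ℕ} (b : Fin n → ℤ) : (Edge n → ℝ) →ₗ[ℝ] ℝ :=
  ∑ e : Edge n, ((b e.1.1 : ℝ) * (b e.1.2 : ℝ)) • LinearMap.proj e

lemma hypSlack_eq {n : ℕ} (b : Fin n → ℤ) (x : Edge n → ℝ) :
    hypSlack b x = (⌊((∑ i, b i : ℤ) : ℝ) ^ 2 / 4⌋ : ℝ) - hypForm b x := by
  simp [hypSlack, hypForm]

lemma convex_setOf_hypSlack_nonneg {n : ℕ} (b : Fin n → ℤ) :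
    Convex ℝ {x : Edge n → ℝ | 0 ≤ hypSlack b x} := by
  simp_rw [hypSlack_eq, sub_nonneg]
  exact convex_halfSpace_le (hypForm b).isLinear _

lemma hypSlack_nonneg_of_mem_cutPolytope {n : ℕ} (b : Fin n → ℤ) {x : Edge n → ℝ}
    (hx : x ∈ cutPolytope n) : 0 ≤ hypSlack b x := by
  refine convexHull_min ?_ (convex_setOf_hypSlack_nonneg b) hx
  rintro _ ⟨S, rfl⟩
  exact hypSlack_cutVector_nonneg b S

lemma cutPolytope_subset_hypermetricPolytope (n : ℕ) : cutPolytope n ⊆ hypermetricPolytope n :=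
  fun _ hx b _ => hypSlack_nonneg_of_mem_cutPolytope b hx

lemma cutVector_mem_cutPolytope {n : ℕ} (S : Finset (Fin n)) : cutVector S ∈ cutPolytope n :=
  subset_convexHull ℝ _ ⟨S, rfl⟩

lemma convex_hypermetricPolytope (n : ℕ) : Convex ℝ (hypermetricPolytope n) := by
  have h : hypermetricPolytope n =
      ⋂ (b : Fin n → ℤ) (_ : IsHypermetric b), {x | 0 ≤ hypSlack b x} := by
    ext x; simp [hypermetricPolytope]
  rw [h]
  exact convex_iInter₂ fun b _ => convex_setOf_hypSlack_nonneg b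

/-! ### Inequalities of negative type -/

lemma IsNegativeType.isHypermetric_add_single {n : ℕ} {b : Fin n → ℤ} (hb : IsNegativeType b)
    (k : Fin n) {c : ℤ} (hc : |c| = 1) : IsHypermetric (b + Pi.single k c) := by
  obtain ⟨A, hA⟩ := hb
  refine ⟨A, ?_⟩
  have h : ∑ i ∈ A, (b + Pi.single k c : Fin n → ℤ) i - ∑ i ∈ Aᶜ, (b + Pi.single k c : Fin n → ℤ) i =
      (∑ i ∈ A, b i - ∑ i ∈ Aᶜ, b i) + if k ∈ A then c else -c := by
    simp only [Pi.add_apply, Finset.sum_add_distrib, Finset.sum_pi_single']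
    by_cases hk : k ∈ A <;> simp [hk] <;> ring
  rw [h, hA, zero_add]
  split_ifs
  · exact hc
  · rwa [abs_neg]

/-- Edges join distinct vertices, so the form has no b_k² term and is affine in the single entry
b_k. -/
lemma hypForm_add_add_hypForm_sub {n : ℕ} (b : Fin n → ℤ) (k : Fin n) (x : Edge n → ℝ) :
    hypForm (b + Pi.single k 1) x + hypForm (b + Pi.single k (-1)) x = 2 * hypForm b x := by
  simp only [hypForm, LinearMap.sum_apply, LinearMap.smul_apply, LinearMap.proj_apply, smul_eq_mul,
    ← Finset.sum_add_distrib, Finset.mul_sum, Pi.add_apply]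
  refine Finset.sum_congr rfl fun e _ => ?_
  have hne : e.1.1 ≠ e.1.2 := e.2.ne
  by_cases h1 : e.1.1 = k
  · have h2 : e.1.2 ≠ k := fun h => hne (h1.trans h.symm)
    simp only [h1, Pi.single_eq_same, Pi.single_eq_of_ne h2]
    push_cast
    ring
  · by_cases h2 : e.1.2 = k
    · simp only [h2, Pi.single_eq_same, Pi.single_eq_of_ne h1]
      push_cast
      ring
    · simp only [Pi.single_eq_of_ne h1, Pi.single_eq_of_ne h2]
      push_cast
      ring

/-- The inequalities of negative type are implied by the hypermetric inequalities. -/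
lemma IsNegativeType.hypSlack_nonneg {n : ℕ} (hn : 0 < n) {b : Fin n → ℤ} (hb : IsNegativeType b)
    {x : Edge n → ℝ} (hx : x ∈ hypermetricPolytope n) : 0 ≤ hypSlack b x := by
  let k : Fin n := ⟨0, hn⟩
  have h1 := hx _ (hb.isHypermetric_add_single k (c := 1) (by simp))
  have h2 := hx _ (hb.isHypermetric_add_single k (c := -1) (by simp))
  have h3 := hypForm_add_add_hypForm_sub b k x
  obtain ⟨A, hA⟩ := hb
  obtain ⟨t, ht⟩ : ∃ t : ℤ, ∑ i, b i = 2 * t :=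
    ⟨∑ i ∈ A, b i, by rw [← Finset.sum_add_sum_compl A]; linarith⟩
  have hs : ∀ c : ℤ, ∑ i, (b + Pi.single k c : Fin n → ℤ) i = 2 * t + c := fun c => by
    simp [Finset.sum_add_distrib, ht]
  rw [hypSlack_eq, hs] at h1 h2
  rw [hypSlack_eq, ht]
  -- The right sides for sums 2t + 1 and 2t - 1 are t² + t and t² - t. Their average is exactly t²,
  -- so averaging loses nothing.
  have e0 : ⌊((2 * t : ℤ) : ℝ) ^ 2 / 4⌋ = t ^ 2 := by
    rw [Int.floor_eq_iff]; push_cast; constructor <;> linarith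
  have e1 : ⌊((2 * t + 1 : ℤ) : ℝ) ^ 2 / 4⌋ = t ^ 2 + t := by
    rw [Int.floor_eq_iff]; push_cast; constructor <;> linarith
  have e2 : ⌊((2 * t + -1 : ℤ) : ℝ) ^ 2 / 4⌋ = t ^ 2 - t := by
    rw [Int.floor_eq_iff]; push_cast; constructor <;> linarith
  rw [e1] at h1
  rw [e2] at h2
  rw [e0]
  push_cast at h1 h2 ⊢
  linarith

/-! ### The vectors `bVec` and `bVecOf` -/

lemma sum_bVec (m : ℕ) : ∑ i, bVec m i = 2 := by
  simp [bVec, Fin.sum_univ_castSucc]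
  ring

lemma sum_bVecOf {m : ℕ} (T : Finset (Fin m)) : ∑ i, bVecOf T i = 2 := by
  simp [bVecOf, Fin.sum_univ_castSucc]

/-- The entry 1 alone balances all the others, which also sum to 1. -/
lemma isNegativeType_of_sum_eq_two {n : ℕ} {b : Fin n → ℤ} (hb : ∑ i, b i = 2) {k : Fin n}
    (hk : b k = 1) : IsNegativeType b := by
  refine ⟨{k}, ?_⟩
  have h := Finset.sum_add_sum_compl {k} b
  rw [Finset.sum_singleton] at h ⊢
  linarith

lemma isNegativeType_bVec {m : ℕ} (hm : 1 ≤ m) : IsNegativeType (bVec m) :=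
  isNegativeType_of_sum_eq_two (sum_bVec m) (k := Fin.castSucc ⟨0, hm⟩)
    (by rw [bVec, Fin.snoc_castSucc])

lemma isNegativeType_bVecOf {m : ℕ} {T : Finset (Fin m)} (hT : T.Nonempty) :
    IsNegativeType (bVecOf T) := by
  obtain ⟨k, hk⟩ := hT
  exact isNegativeType_of_sum_eq_two (sum_bVecOf T) (k := k.castSucc)
    (by rw [bVecOf, Fin.snoc_castSucc, if_pos hk])

/-- Edges of `K_{m+1}` are edges of `K_m` or contain the last vertex. -/
lemma sum_edge_succ {m : ℕ} (g : Edge (m + 1) → ℝ) :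
    ∑ e, g e = ∑ e : Edge m,
        g ⟨(e.1.1.castSucc, e.1.2.castSucc), Fin.castSucc_lt_castSucc_iff.mpr e.2⟩ +
      ∑ i : Fin m, g ⟨(i.castSucc, Fin.last m), Fin.castSucc_lt_last i⟩ := by
  let F : Edge m ⊕ Fin m → Edge (m + 1) := Sum.elim
    (fun e => ⟨(e.1.1.castSucc, e.1.2.castSucc), Fin.castSucc_lt_castSucc_iff.mpr e.2⟩)
    (fun i => ⟨(i.castSucc, Fin.last m), Fin.castSucc_lt_last i⟩)
  have hF : Function.Bijective F := by
    constructor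
    · rintro (⟨⟨a, b⟩, hab⟩ | i) (⟨⟨c, d⟩, hcd⟩ | j) h
      · simpa [F] using h
      · simp [F, Fin.castSucc_ne_last] at h
      · simp [F, (Fin.castSucc_ne_last _).symm] at h
      · simpa [F] using h
    · rintro ⟨⟨i, j⟩, hij⟩
      have hi : i ≠ Fin.last m := (hij.trans_le (Fin.le_last j)).ne
      obtain ⟨i, rfl⟩ := Fin.exists_castSucc_eq.mpr hi
      by_cases hj : j = Fin.last m
      · subst hj
        exact ⟨Sum.inr i, rfl⟩
      · obtain ⟨j, rfl⟩ := Fin.exists_castSucc_eq.mpr hj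
        exact ⟨Sum.inl ⟨(i, j), Fin.castSucc_lt_castSucc_iff.mp hij⟩, rfl⟩
  rw [← hF.sum_comp, Fintype.sum_sum_type]
  rfl

lemma hypSlack_bVec (m : ℕ) (x : Edge (m + 1) → ℝ) :
    hypSlack (bVec m) x =
      1 + (((m + 1 : ℕ) : ℝ) - 3) *
          ∑ i : Fin m, x ⟨(i.castSucc, Fin.last m), Fin.castSucc_lt_last i⟩
        - ∑ e : Edge m,
            x ⟨(e.1.1.castSucc, e.1.2.castSucc), Fin.castSucc_lt_castSucc_iff.mpr e.2⟩ := by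
  rw [hypSlack, sum_bVec, sum_edge_succ]
  simp only [bVec, Fin.snoc_castSucc, Fin.snoc_last, Finset.mul_sum]
  norm_num [← Finset.mul_sum]
  ring

lemma sum_bVec_of_last_notMem {m : ℕ} {S : Finset (Fin (m + 1))} (hS : Fin.last m ∉ S) :
    ∑ i ∈ S, (bVec m i : ℝ) = S.card := by
  rw [Finset.card_eq_sum_ones, Nat.cast_sum]
  refine Finset.sum_congr rfl fun i hi => ?_
  have hne : i ≠ Fin.last m := fun h => hS (h ▸ hi)
  obtain ⟨j, rfl⟩ := Fin.exists_castSucc_eq.mpr hne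
  simp [bVec]

lemma hypSlack_bVecOf_cutVector {m : ℕ} (T S : Finset (Fin m)) :
    hypSlack (bVecOf T) (cutVector (S.map Fin.castSuccEmb)) =
      (((S ∩ T).card : ℝ) - 1) ^ 2 := by
  rw [hypSlack_cutVector_of_sum_eq_two (sum_bVecOf T)]
  simp [bVecOf, Finset.sum_map]

/-- For T = ∅ the vector is (0, …, 0, 2), which is not of negative type. Its validity is checked
directly: the smaller end of an edge is never the last vertex, so the linear form vanishes. -/
lemma bVecOf_empty_apply {m : ℕ} (e : Edge (m + 1)) :
    bVecOf (∅ : Finset (Fin m)) e.1.1 = 0 := by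
  have hne : e.1.1 ≠ Fin.last m := (e.2.trans_le (Fin.le_last _)).ne
  obtain ⟨j, hj⟩ := Fin.exists_castSucc_eq.mpr hne
  rw [← hj]
  simp [bVecOf]

lemma hypSlack_bVecOf_nonneg {m : ℕ} (T : Finset (Fin m)) {x : Edge (m + 1) → ℝ}
    (hx : x ∈ hypermetricPolytope (m + 1)) : 0 ≤ hypSlack (bVecOf T) x := by
  rcases T.eq_empty_or_nonempty with rfl | hT
  · rw [hypSlack, sum_bVecOf, Finset.sum_eq_zero fun e _ => by simp [bVecOf_empty_apply e]]
    norm_num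
  · exact (isNegativeType_bVecOf hT).hypSlack_nonneg m.succ_pos hx

/-! ### Rectangles that avoid intersections of size one -/

/-- Induction on the ground set: after removal of x, the disjoint pairs inject into those of two
rectangles, one with x erased from the first sets and absent from the second, the other with the
roles exchanged. Erasing x does not change the intersection with a set that avoids x, so both
rectangles inherit the hypothesis and the bound doubles. -/
lemma card_disjoint_pairs_le {α : Type*} [DecidableEq α] (s : Finset α) :
    ∀ 𝒜 ℬ : Finset (Finset α), (∀ a ∈ 𝒜, a ⊆ s) → (∀ b ∈ ℬ, b ⊆ s) →
      (∀ a ∈ 𝒜, ∀ b ∈ ℬ, (a ∩ b).card ≠ 1) →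
      ((𝒜 ×ˢ ℬ).filter fun p => Disjoint p.1 p.2).card ≤ 2 ^ s.card := by
  induction s using Finset.induction_on with
  | empty =>
    intro 𝒜 ℬ h𝒜 hℬ _
    have h : ((𝒜 ×ˢ ℬ).filter fun p => Disjoint p.1 p.2) ⊆ {(∅, ∅)} := by
      rintro ⟨a, b⟩ hab
      simp only [Finset.mem_filter, Finset.mem_product] at hab
      simp [Finset.subset_empty.mp (h𝒜 a hab.1.1), Finset.subset_empty.mp (hℬ b hab.1.2)]
    simpa using Finset.card_le_card h
  | insert x s hxs ih =>
    intro 𝒜 ℬ h𝒜 hℬ hab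
    have hsub : ∀ a ⊆ insert x s, a.erase x ⊆ s := fun a ha => by
      simpa [Finset.subset_insert_iff] using ha
    have hcard : ∀ a b : Finset α, x ∉ b → a.erase x ∩ b = a ∩ b := fun a b hb => by
      ext y; simp only [Finset.mem_inter, Finset.mem_erase]
      exact ⟨fun h => ⟨h.1.2, h.2⟩, fun h => ⟨⟨fun e => hb (e ▸ h.2), h.1⟩, h.2⟩⟩
    -- the two rectangles on the smaller ground set
    let D : Finset (Finset α) → Finset (Finset α) → Finset (Finset α × Finset α) :=
      fun 𝒞 𝒟 => (𝒞 ×ˢ 𝒟).filter fun p => Disjoint p.1 p.2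
    have ih1 := ih (𝒜.image (·.erase x)) (ℬ.filter (x ∉ ·))
      (by simpa using fun a ha => hsub a (h𝒜 a ha))
      (fun b hb => by
        rw [Finset.mem_filter] at hb
        simpa [Finset.erase_eq_of_notMem hb.2] using hsub b (hℬ b hb.1))
      (by
        simp only [Finset.mem_image, Finset.mem_filter]
        rintro _ ⟨a, ha, rfl⟩ b ⟨hb, hxb⟩
        rw [hcard a b hxb]
        exact hab a ha b hb)
    have ih2 := ih (𝒜.filter (x ∉ ·)) (ℬ.image (·.erase x))
      (fun b hb => by
        rw [Finset.mem_filter] at hb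
        simpa [Finset.erase_eq_of_notMem hb.2] using hsub b (h𝒜 b hb.1))
      (by simpa using fun a ha => hsub a (hℬ a ha))
      (by
        simp only [Finset.mem_image, Finset.mem_filter]
        rintro a ⟨ha, hxa⟩ _ ⟨b, hb, rfl⟩
        rw [Finset.inter_comm, hcard b a hxa, Finset.inter_comm]
        exact hab a ha b hb)
    -- A pair (a, b) with x in neither set fits both sides. It is sent left only if a ∪ {x} ∉ 𝒜, so
    -- it cannot collide there with (a ∪ {x}, b).
    let f : Finset α × Finset α → (Finset α × Finset α) ⊕ (Finset α × Finset α) := fun p =>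
      if x ∈ p.1 then Sum.inl (p.1.erase x, p.2)
      else if x ∈ p.2 then Sum.inr (p.1, p.2.erase x)
      else if insert x p.1 ∈ 𝒜 then Sum.inr p else Sum.inl p
    have hmaps : ∀ p ∈ D 𝒜 ℬ, f p ∈
        (D (𝒜.image (·.erase x)) (ℬ.filter (x ∉ ·))).disjSum
          (D (𝒜.filter (x ∉ ·)) (ℬ.image (·.erase x))) := by
      rintro ⟨a, b⟩ hp
      simp only [D, Finset.mem_filter, Finset.mem_product] at hp
      obtain ⟨⟨ha, hb⟩, hd⟩ := hp
      by_cases hxa : x ∈ a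
      · have hxb : x ∉ b := Finset.disjoint_left.mp hd hxa
        simp only [f, hxa, if_true, Finset.inl_mem_disjSum, D, Finset.mem_filter,
          Finset.mem_product, Finset.mem_image]
        exact ⟨⟨⟨a, ha, rfl⟩, hb, hxb⟩, hd.mono_left (Finset.erase_subset _ _)⟩
      · by_cases hxb : x ∈ b
        · simp only [f, hxa, hxb, if_true, if_false, Finset.inr_mem_disjSum, D, Finset.mem_filter,
            Finset.mem_product, Finset.mem_image]
          exact ⟨⟨⟨ha, not_false⟩, b, hb, rfl⟩, hd.mono_right (Finset.erase_subset _ _)⟩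
        · by_cases hi : insert x a ∈ 𝒜
          · simp only [f, hxa, hxb, hi, if_true, if_false, Finset.inr_mem_disjSum, D,
              Finset.mem_filter, Finset.mem_product, Finset.mem_image]
            exact ⟨⟨⟨ha, not_false⟩, b, hb, Finset.erase_eq_of_notMem hxb⟩, hd⟩
          · simp only [f, hxa, hxb, hi, if_false, Finset.inl_mem_disjSum, D,
              Finset.mem_filter, Finset.mem_product, Finset.mem_image]
            exact ⟨⟨⟨a, ha, Finset.erase_eq_of_notMem hxa⟩, hb, not_false⟩, hd⟩
    -- This rules out collisions on the right: if a ∪ {x} ∈ 𝒜 and b ∪ {x} ∈ ℬ with a, b disjoint,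
    -- these two sets would meet exactly in x.
    have hone : ∀ a b : Finset α, Disjoint a (b.erase x) → insert x a ∈ 𝒜 → b ∈ ℬ → x ∉ b := by
      intro a b hd ha hb hxb
      refine hab _ ha b hb ?_
      rw [Finset.card_eq_one]
      refine ⟨x, ?_⟩
      ext y
      simp only [Finset.mem_inter, Finset.mem_insert, Finset.mem_singleton]
      refine ⟨?_, fun h => ⟨Or.inl h, h ▸ hxb⟩⟩
      rintro ⟨h | h, hy⟩
      · exact h
      · by_contra hne
        exact Finset.disjoint_left.mp hd h (Finset.mem_erase.mpr ⟨hne, hy⟩)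
    have hinj : Set.InjOn f (D 𝒜 ℬ : Set (Finset α × Finset α)) := by
      rintro ⟨a, b⟩ hp ⟨c, d⟩ hq hpq
      simp only [D, Finset.coe_filter, Finset.mem_product, Set.mem_ofPred_eq] at hp hq
      obtain ⟨⟨ha, hb⟩, hd⟩ := hp
      obtain ⟨⟨hc, hd'⟩, hd2⟩ := hq
      simp only [f] at hpq
      have ea : x ∈ a → insert x (a.erase x) = a := Finset.insert_erase
      have eb : x ∈ b → insert x (b.erase x) = b := Finset.insert_erase
      have ec : x ∈ c → insert x (c.erase x) = c := Finset.insert_erase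
      have ed : x ∈ d → insert x (d.erase x) = d := Finset.insert_erase
      have hab' := hone a b (hd.mono_right (Finset.erase_subset _ _))
      have hcd' := hone c d (hd2.mono_right (Finset.erase_subset _ _))
      clear ih ih1 ih2 hmaps hab h𝒜 hℬ hsub hcard hone hd hd2
      rw [Prod.mk.injEq]
      split_ifs at hpq <;>
        simp only [Sum.inl.injEq, Sum.inr.injEq, Prod.mk.injEq] at hpq <;>
        obtain ⟨e1, e2⟩ := hpq <;> simp_all
    calc (D 𝒜 ℬ).card ≤ _ := Finset.card_le_card_of_injOn f hmaps hinj
      _ ≤ 2 ^ s.card + 2 ^ s.card := by rw [Finset.card_disjSum]; exact add_le_add ih1 ih2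
      _ = 2 ^ (insert x s).card := by rw [Finset.card_insert_of_notMem hxs, pow_succ]; ring

/-- Each element independently lies in neither set, in the first or in the second. -/
lemma three_pow_le_card_disjoint_pairs (k : ℕ) :
    3 ^ k ≤ (Finset.univ.filter
      fun p : Finset (Fin k) × Finset (Fin k) => Disjoint p.1 p.2).card := by
  have h : (Finset.univ : Finset (Fin k → Fin 3)).card = 3 ^ k := by simp
  rw [← h]
  refine Finset.card_le_card_of_injOn
    (fun f => (Finset.univ.filter (f · = 1), Finset.univ.filter (f · = 2))) ?_ ?_
  · intro f _
    simp only [Finset.coe_filter, Finset.mem_univ, true_and, Set.mem_ofPred_eq]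
    rw [Finset.disjoint_filter]
    intro i _ h1 h2
    rw [h1] at h2
    exact absurd h2 (by decide)
  · intro f _ g _ hfg
    simp only [Prod.mk.injEq, Finset.ext_iff, Finset.mem_filter, Finset.mem_univ, true_and] at hfg
    funext i
    have h1 := hfg.1 i
    have h2 := hfg.2 i
    generalize f i = u at *
    generalize g i = v at *
    revert h1 h2
    revert u v
    decide

/-- If rectangles without pairs that meet in one element cover all disjoint pairs `(a, b)`
with `a ≠ ∅`, then there are at least `(3 / 2) ^ k - 1` of them. -/
lemma three_pow_le_of_rectangle_cover {k : ℕ} {ι : Type*} [Fintype ι]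
    (𝒜 ℬ : ι → Set (Finset (Fin k)))
    (hone : ∀ i, ∀ a ∈ 𝒜 i, ∀ b ∈ ℬ i, (a ∩ b).card ≠ 1)
    (hcover : ∀ a b : Finset (Fin k), a.Nonempty → Disjoint a b → ∃ i, a ∈ 𝒜 i ∧ b ∈ ℬ i) :
    3 ^ k ≤ (Fintype.card ι + 1) * 2 ^ k := by
  classical
  -- The extra index `none` carries the rectangle {∅} × everything for the pairs with a = ∅; it
  -- accounts for the + 1 in the bound.
  let R : Option ι → Finset (Finset (Fin k) × Finset (Fin k)) := fun o =>
    ((o.elim {∅} fun i => Finset.univ.filter (· ∈ 𝒜 i)) ×ˢ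
      (o.elim Finset.univ fun i => Finset.univ.filter (· ∈ ℬ i))).filter
        fun p => Disjoint p.1 p.2
  have hR : ∀ o, (R o).card ≤ 2 ^ k := by
    intro o
    have := card_disjoint_pairs_le (Finset.univ : Finset (Fin k))
      (o.elim {∅} fun i => Finset.univ.filter (· ∈ 𝒜 i))
      (o.elim Finset.univ fun i => Finset.univ.filter (· ∈ ℬ i))
      (fun _ _ => Finset.subset_univ _) (fun _ _ => Finset.subset_univ _)
      (by
        cases o with
        | none => simp
        | some i => simpa using hone i)
    simpa using this
  have hsub : (Finset.univ.filter
      fun p : Finset (Fin k) × Finset (Fin k) => Disjoint p.1 p.2) ⊆ Finset.univ.biUnion R := by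
    rintro ⟨a, b⟩ hp
    have hd : Disjoint a b := by simpa using hp
    rw [Finset.mem_biUnion]
    rcases a.eq_empty_or_nonempty with rfl | ha
    · exact ⟨none, Finset.mem_univ _, by simp [R]⟩
    · obtain ⟨i, hi⟩ := hcover a b ha hd
      exact ⟨some i, Finset.mem_univ _, by simp [R, hi, hd]⟩
  calc 3 ^ k ≤ _ := three_pow_le_card_disjoint_pairs k
    _ ≤ _ := Finset.card_le_card hsub
    _ ≤ _ := Finset.card_biUnion_le
    _ ≤ ∑ _o : Option ι, 2 ^ k := Finset.sum_le_sum fun o _ => hR o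
    _ = _ := by simp

/-! ### Faces of a polytope are intersections of facets -/

lemma linearMap_apply_eq_of_mem_convexHull {E : Type*} [AddCommGroup E] [Module ℝ E]
    (m : E →ₗ[ℝ] ℝ) {V : Set E} {c : ℝ} (h : ∀ v ∈ V, m v = c) {x : E}
    (hx : x ∈ convexHull ℝ V) : m x = c :=
  convexHull_min (t := {x | m x = c}) h (convex_hyperplane m.isLinear c) hx

lemma linearMap_apply_le_of_mem_convexHull {E : Type*} [AddCommGroup E] [Module ℝ E]
    (m : E →ₗ[ℝ] ℝ) {V : Set E} {c : ℝ} (h : ∀ v ∈ V, m v ≤ c) {x : E}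
    (hx : x ∈ convexHull ℝ V) : m x ≤ c :=
  convexHull_min (t := {x | m x ≤ c}) h (convex_halfSpace_le m.isLinear c) hx

lemma vectorSpan_le_ker {E : Type*} [AddCommGroup E] [Module ℝ E]
    (m : E →ₗ[ℝ] ℝ) {F : Set E} {c : ℝ} (h : ∀ v ∈ F, m v = c) :
    vectorSpan ℝ F ≤ LinearMap.ker m := by
  rw [vectorSpan_def, Submodule.span_le]
  rintro _ ⟨x, hx, y, hy, rfl⟩
  simp [h x hx, h y hy]

/-- A supporting functional `l` whose face does not contain `q` and has codimension at least two
can be rotated to one whose face is larger and still does not contain `q`. -/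
lemma exists_supporting_of_finrank_lt {E : Type*} [AddCommGroup E] [Module ℝ E]
    [FiniteDimensional ℝ E] {V : Set E} (hV : V.Finite) (l : E →ₗ[ℝ] ℝ) {p q : E}
    (hp : p ∈ convexHull ℝ V) (hl : ∀ y ∈ convexHull ℝ V, l y ≤ l p)
    (hlq : l q < l p)
    (hdim : Module.finrank ℝ (vectorSpan ℝ {x ∈ convexHull ℝ V | l x = l p}) + 1 <
      Module.finrank ℝ (vectorSpan ℝ (convexHull ℝ V))) :
    ∃ l' : E →ₗ[ℝ] ℝ, (∀ y ∈ convexHull ℝ V, l' y ≤ l' p) ∧ l' q < l' p ∧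
      (∀ x ∈ convexHull ℝ V, l x = l p → l' x = l' p) ∧
      Module.finrank ℝ (vectorSpan ℝ {x ∈ convexHull ℝ V | l x = l p}) <
        Module.finrank ℝ (vectorSpan ℝ {x ∈ convexHull ℝ V | l' x = l' p}) := by
  set Q := convexHull ℝ V with hQ
  set F := {x ∈ Q | l x = l p} with hF
  have hpF : p ∈ F := ⟨hp, rfl⟩
  -- A functional that vanishes on U is constant on F and equal at p and q, so adding multiples of
  -- it to l keeps F in the face and the gap at q. As F has codimension at least two, U does not
  -- contain all directions of Q.
  let U := vectorSpan ℝ F ⊔ Submodule.span ℝ {q - p}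
  have hU : ¬ vectorSpan ℝ Q ≤ U := by
    intro h
    have h1 := Submodule.finrank_mono h
    have h2 : Module.finrank ℝ U ≤ _ := Submodule.finrank_add_le_finrank_add_finrank _ _
    have h3 := finrank_span_le_card (R := ℝ) ({q - p} : Set E)
    rw [Set.toFinset_singleton, Finset.card_singleton] at h3
    omega
  obtain ⟨w, hwQ, hwU⟩ := SetLike.not_le_iff_exists.mp hU
  obtain ⟨m₀, hm₀w, hm₀U⟩ := Submodule.exists_le_ker_of_notMem hwU
  -- up to sign, `m₀` is larger at some point of `V` than at `p`
  obtain ⟨m, hmU, v, hvV, hmv⟩ : ∃ m : E →ₗ[ℝ] ℝ, U ≤ LinearMap.ker m ∧ ∃ v ∈ V, m p < m v := by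
    by_contra! hcon
    have h1 := hcon m₀ hm₀U
    have h2 := hcon (-m₀) (fun x hx => by simpa using hm₀U hx)
    have h3 : ∀ v ∈ V, m₀ v = m₀ p := fun v hv =>
      le_antisymm (h1 v hv) (by simpa using h2 v hv)
    exact hm₀w (vectorSpan_le_ker m₀
      (fun x hx => linearMap_apply_eq_of_mem_convexHull m₀ h3 hx) hwQ)
  have hmq : m q = m p := by
    have : q - p ∈ U := Submodule.mem_sup_right (Submodule.mem_span_singleton_self _)
    have := hmU this
    rwa [LinearMap.mem_ker, map_sub, sub_eq_zero] at this
  have hmF : ∀ x ∈ F, m x = m p := fun x hx => by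
    have : x - p ∈ U := Submodule.mem_sup_left (vsub_mem_vectorSpan ℝ hx hpF)
    have := hmU this
    rwa [LinearMap.mem_ker, map_sub, sub_eq_zero] at this
  -- Ratio test: the minimal ratio is the largest t for which l + t m is still maximal at p, and the
  -- minimizer u then joins the face.
  obtain ⟨u, ⟨huV, hmu⟩, humin⟩ := Set.exists_min_image {v ∈ V | m p < m v}
    (fun v => (l p - l v) / (m v - m p)) (hV.subset (Set.sep_subset _ _)) ⟨v, hvV, hmv⟩
  have hVQ : ∀ v ∈ V, v ∈ Q := fun v hv => subset_convexHull ℝ V hv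
  have hlu : l u < l p := lt_of_le_of_ne (hl u (hVQ u huV)) fun h =>
    hmu.ne' (hmF u ⟨hVQ u huV, h⟩)
  set t := (l p - l u) / (m u - m p) with ht
  have ht0 : 0 < t := div_pos (sub_pos.mpr hlu) (sub_pos.mpr hmu)
  have htu : t * (m u - m p) = l p - l u := div_mul_cancel₀ _ (sub_pos.mpr hmu).ne'
  have happ : ∀ x, (l + t • m) x = l x + t * m x := fun x => by simp
  have hl'F : ∀ x ∈ Q, l x = l p → (l + t • m) x = (l + t • m) p := fun x hx hxp => by
    rw [happ, happ, hxp, hmF x ⟨hx, hxp⟩]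
  refine ⟨l + t • m, fun y hy => linearMap_apply_le_of_mem_convexHull _ (fun v hv => ?_) hy, ?_,
    hl'F, ?_⟩
  · rw [happ, happ]
    rcases le_or_gt (m v) (m p) with h | h
    · nlinarith [hl v (hVQ v hv)]
    · have := (le_div_iff₀ (sub_pos.mpr h)).mp (humin v ⟨hv, h⟩)
      linarith
  · rw [happ, happ, hmq]
    linarith
  · refine Submodule.finrank_lt_finrank_of_lt (lt_of_le_of_ne ?_ fun h => ?_)
    · exact vectorSpan_mono ℝ fun x hx => ⟨hx.1, hl'F x hx.1 hx.2⟩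
    · have h1 : u - p ∈ vectorSpan ℝ {x ∈ Q | (l + t • m) x = (l + t • m) p} :=
        vsub_mem_vectorSpan ℝ ⟨hVQ u huV, by rw [happ, happ]; linarith⟩ ⟨hp, rfl⟩
      rw [← h] at h1
      have h2 := vectorSpan_le_ker l (fun x (hx : x ∈ F) => hx.2) h1
      rw [LinearMap.mem_ker, map_sub, sub_eq_zero] at h2
      exact hlu.ne h2

/-- A supporting functional whose face does not contain `q` can be rotated to one whose face is
larger, has codimension one, and still does not contain `q`. -/
lemma exists_supporting_of_codim_one {E : Type*} [AddCommGroup E] [Module ℝ E]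
    [FiniteDimensional ℝ E] {V : Set E} (hV : V.Finite) {p q : E}
    (hp : p ∈ convexHull ℝ V) (hq : q ∈ convexHull ℝ V) (l : E →ₗ[ℝ] ℝ)
    (hl : ∀ y ∈ convexHull ℝ V, l y ≤ l p) (hlq : l q < l p) :
    ∃ l' : E →ₗ[ℝ] ℝ, (∀ y ∈ convexHull ℝ V, l' y ≤ l' p) ∧ l' q < l' p ∧
      (∀ x ∈ convexHull ℝ V, l x = l p → l' x = l' p) ∧
      Module.finrank ℝ (vectorSpan ℝ {x ∈ convexHull ℝ V | l' x = l' p}) + 1 =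
        Module.finrank ℝ (vectorSpan ℝ (convexHull ℝ V)) := by
  induction hk : Module.finrank ℝ (vectorSpan ℝ (convexHull ℝ V)) -
      Module.finrank ℝ (vectorSpan ℝ {x ∈ convexHull ℝ V | l x = l p})
    using Nat.strong_induction_on generalizing l with
  | _ k ih =>
  have hlt : Module.finrank ℝ (vectorSpan ℝ {x ∈ convexHull ℝ V | l x = l p}) <
      Module.finrank ℝ (vectorSpan ℝ (convexHull ℝ V)) := by
    refine Submodule.finrank_lt_finrank_of_lt (lt_of_le_of_ne ?_ fun h => ?_)
    · exact vectorSpan_mono ℝ (Set.sep_subset _ _)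
    · have h1 : q - p ∈ vectorSpan ℝ (convexHull ℝ V) := vsub_mem_vectorSpan ℝ hq hp
      rw [← h] at h1
      have h2 := vectorSpan_le_ker l
        (fun x (hx : x ∈ {x ∈ convexHull ℝ V | l x = l p}) => hx.2) h1
      rw [LinearMap.mem_ker, map_sub, sub_eq_zero] at h2
      exact hlq.ne h2
  rcases Nat.lt_or_ge (Module.finrank ℝ (vectorSpan ℝ {x ∈ convexHull ℝ V | l x = l p}) + 1)
    (Module.finrank ℝ (vectorSpan ℝ (convexHull ℝ V))) with hdim | hdim
  · obtain ⟨l₁, h1, h2, h3, h4⟩ := exists_supporting_of_finrank_lt hV l hp hl hlq hdim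
    obtain ⟨l', h1', h2', h3', h4'⟩ := ih _ (by omega) l₁ h1 h2 rfl
    exact ⟨l', h1', h2', fun x hx hx' => h3' x hx (h3 x hx hx'), h4'⟩
  · exact ⟨l, hl, hlq, fun _ _ h => h, by omega⟩

/-- For a face `{x ∈ Q | l x = l p}` of a polytope `Q` and a point `q` of `Q` that is not in it
there is a facet that contains the face but not `q`. -/
lemma exists_mem_facets {d : Type*} [Fintype d] {Q : Set (d → ℝ)} (hQ : IsPolytope Q)
    {p q : d → ℝ} (hp : p ∈ Q) (hq : q ∈ Q) (l : (d → ℝ) →ₗ[ℝ] ℝ)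
    (hl : ∀ y ∈ Q, l y ≤ l p) (hlq : l q < l p) :
    ∃ F ∈ facets Q, {x ∈ Q | l x = l p} ⊆ F ∧ q ∉ F := by
  obtain ⟨V, hV, rfl⟩ := hQ
  obtain ⟨l', h1, h2, h3, h4⟩ := exists_supporting_of_codim_one hV hp hq l hl hlq
  refine ⟨{x ∈ convexHull ℝ V | l' x = l' p}, ⟨⟨p, hp, rfl⟩, fun _ => ?_, h4⟩,
    fun x hx => ⟨hx.1, h3 x hx.1 hx.2⟩, fun h => h2.ne h.2⟩
  refine ⟨LinearMap.toContinuousLinearMap l', ?_⟩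
  ext x
  simp only [Set.mem_ofPred_eq, LinearMap.coe_toContinuousLinearMap']
  exact and_congr_right fun hx =>
    ⟨fun h y hy => (h1 y hy).trans_eq h.symm, fun h => le_antisymm (h1 x hx) (h p hp)⟩

/-! ### Finitely many inequalities describe the convex hull of finitely many points -/

/-- A finitely generated cone is the solution set of finitely many homogeneous inequalities. -/
lemma exists_finite_forms_cone {E : Type*} [AddCommGroup E] [Module ℝ E] [FiniteDimensional ℝ E]
    {κ : Type*} [DecidableEq κ] (v : κ → E) (s : Finset κ) :
    ∃ (N : Type) (_ : Finite N) (f : N → E →ₗ[ℝ] ℝ), ∀ x,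
      (∃ w : κ → ℝ, (∀ j, 0 ≤ w j) ∧ ∑ j ∈ s, w j • v j = x) ↔ ∀ i, f i x ≤ 0 := by
  induction s using Finset.induction_on with
  | empty =>
    let B := Module.finBasis ℝ E
    refine ⟨Fin (Module.finrank ℝ E) ⊕ Fin (Module.finrank ℝ E), inferInstance,
      Sum.elim B.coord (fun i => -B.coord i), fun x => ?_⟩
    simp only [Finset.sum_empty, Sum.forall, Sum.elim_inl, Sum.elim_inr, LinearMap.neg_apply,
      neg_nonpos]
    constructor
    · rintro ⟨_, _, rfl⟩
      simp
    · rintro ⟨h1, h2⟩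
      refine ⟨0, by simp, Eq.symm ?_⟩
      rw [← B.forall_coord_eq_zero_iff]
      exact fun i => le_antisymm (h1 i) (h2 i)
  | insert k s hk ih =>
    obtain ⟨N, hN, f, hf⟩ := ih
    classical
    -- eliminate `t` from `f i x - t * f i (v k) ≤ 0`, `0 ≤ t`
    refine ⟨(N × N) ⊕ N, inferInstance, Sum.elim
      (fun p => if 0 < f p.1 (v k) ∧ f p.2 (v k) < 0 then
        (-f p.2 (v k)) • f p.1 + f p.1 (v k) • f p.2 else 0)
      (fun i => if f i (v k) ≤ 0 then f i else 0), fun x => ?_⟩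
    have hstep : (∃ w : κ → ℝ, (∀ j, 0 ≤ w j) ∧ ∑ j ∈ insert k s, w j • v j = x) ↔
        ∃ t : ℝ, 0 ≤ t ∧ ∀ i, f i x ≤ t * f i (v k) := by
      have h1 : ∀ t : ℝ, (∀ i, f i x ≤ t * f i (v k)) ↔ ∀ i, f i (x - t • v k) ≤ 0 := by
        intro t; simp
      simp_rw [h1, ← hf]
      constructor
      · rintro ⟨w, hw, rfl⟩
        exact ⟨w k, hw k, w, hw, by rw [Finset.sum_insert hk]; abel⟩
      · rintro ⟨t, ht, w, hw, hx⟩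
        refine ⟨Function.update w k t, fun j => ?_, ?_⟩
        · by_cases hj : j = k
          · subst hj; simpa using ht
          · simpa [hj] using hw j
        · rw [Finset.sum_insert hk, Function.update_self,
            Finset.sum_congr rfl fun j hj => by
              rw [Function.update_of_ne (ne_of_mem_of_not_mem hj hk)], hx]
          abel
    rw [hstep]
    constructor
    · rintro ⟨t, ht, h⟩ (⟨i, j⟩ | i)
      · simp only [Sum.elim_inl]
        split_ifs with hij
        · obtain ⟨hi, hj⟩ := hij
          simp only [LinearMap.add_apply, LinearMap.smul_apply, smul_eq_mul]
          nlinarith [mul_le_mul_of_nonneg_left (h i) (neg_pos.mpr hj).le,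
            mul_le_mul_of_nonneg_left (h j) hi.le]
        · simp
      · simp only [Sum.elim_inr]
        split_ifs with hi
        · exact (h i).trans (mul_nonpos_of_nonneg_of_nonpos ht hi)
        · simp
    · intro h
      have hle : ∀ i, f i (v k) ≤ 0 → f i x ≤ 0 := fun i hi => by
        simpa [hi] using h (Sum.inr i)
      have hpair : ∀ i j, 0 < f i (v k) → f j (v k) < 0 →
          -f j (v k) * f i x + f i (v k) * f j x ≤ 0 := fun i j hi hj => by
        simpa [hi, hj] using h (Sum.inl (i, j))
      -- Forms positive at v k bound t from below, negative ones from above. The largest lower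
      -- bound, or 0 if that is larger, works; without lower bounds t = 0 does.
      by_cases hpos : ∃ i, 0 < f i (v k)
      · obtain ⟨i, hi, hmax⟩ := Set.exists_max_image {i | 0 < f i (v k)}
          (fun i => f i x / f i (v k)) (Set.toFinite _) hpos
        rw [Set.mem_ofPred_eq] at hi
        have hr : f i x / f i (v k) * f i (v k) = f i x := div_mul_cancel₀ _ hi.ne'
        set r := f i x / f i (v k) with hr_def
        refine ⟨max 0 r, le_max_left _ _, fun j => ?_⟩
        rcases lt_trichotomy (f j (v k)) 0 with hj | hj | hj
        · rcases max_choice 0 r with h0 | h0 <;> rw [h0]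
          · simpa using hle j hj.le
          · have := hpair i j hi hj
            rw [← hr] at this
            have h2 : f i (v k) * (f j x - r * f j (v k)) ≤ 0 := by linarith
            nlinarith [(mul_nonpos_iff_pos_imp_nonpos.mp h2).1 hi]
        · rw [hj, mul_zero]
          exact hle j hj.le
        · exact (div_le_iff₀ hj).mp ((hmax j hj).trans (le_max_right _ _))
      · push Not at hpos
        exact ⟨0, le_rfl, fun i => by simpa using hle i (hpos i)⟩

/-- The convex hull of finitely many points is the solution set of finitely many inequalities. -/
lemma exists_finite_system_convexHull {d : Type*} [Fintype d] {κ : Type*} [Fintype κ]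
    (v : κ → d → ℝ) :
    ∃ (N : Type) (_ : Finite N) (A : Matrix N d ℝ) (b : N → ℝ),
      convexHull ℝ (Set.range v) = {x | ∀ i, (A *ᵥ x) i ≤ b i} := by
  classical
  -- Homogenization: the convex hull is the slice at height 1 of the cone generated by the points (v
  -- j, 1).
  obtain ⟨N, hN, f, hf⟩ := exists_finite_forms_cone (fun j => (v j, (1 : ℝ))) Finset.univ
  have hval : ∀ i x, f i (x, 1) = ∑ e, f i (Pi.single e 1, 0) * x e + f i (0, 1) := by
    intro i x
    have h1 : (x, (1 : ℝ)) = (x, 0) + (0, 1) := by simp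
    have h2 : f i (x, 0) = (f i ∘ₗ LinearMap.inl ℝ (d → ℝ) ℝ) x := rfl
    rw [h1, map_add, h2, LinearMap.pi_apply_eq_sum_univ]
    congr 1
    refine Finset.sum_congr rfl fun e _ => ?_
    have h3 : (fun j => if e = j then (1 : ℝ) else 0) = Pi.single e 1 := by
      ext j
      simp [Pi.single_apply, eq_comm]
    rw [h3, smul_eq_mul, mul_comm]
    rfl
  refine ⟨N, hN, Matrix.of fun i e => f i (Pi.single e 1, 0), fun i => -f i (0, 1), ?_⟩
  ext x
  have hrow : ∀ i, ((Matrix.of fun i e => f i (Pi.single e 1, 0)) *ᵥ x) i =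
      ∑ e, f i (Pi.single e 1, 0) * x e := fun i => rfl
  have hx : x ∈ convexHull ℝ (Set.range v) ↔
      ∃ w : κ → ℝ, (∀ j, 0 ≤ w j) ∧ ∑ j, w j • (v j, (1 : ℝ)) = (x, 1) := by
    have hpair : ∀ w : κ → ℝ, ∑ j, w j • (v j, (1 : ℝ)) = (∑ j, w j • v j, ∑ j, w j) := fun w => by
      simp [Prod.ext_iff, Prod.fst_sum, Prod.snd_sum]
    simp_rw [hpair, Prod.mk.injEq]
    constructor
    · intro hx
      refine convexHull_min (t := {x | ∃ w : κ → ℝ, (∀ j, 0 ≤ w j) ∧ ∑ j, w j • v j = x ∧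
        ∑ j, w j = 1}) ?_ ?_ hx
      · rintro _ ⟨j, rfl⟩
        refine ⟨Pi.single j 1, fun k => ?_, ?_, ?_⟩
        · rw [Pi.single_apply]
          split_ifs <;> norm_num
        · simp [Pi.single_apply]
        · simp
      · rintro _ ⟨w, hw, rfl, hw1⟩ _ ⟨u, hu, rfl, hu1⟩ a b ha hb hab
        refine ⟨fun j => a * w j + b * u j, fun j => ?_, ?_, ?_⟩
        · exact add_nonneg (mul_nonneg ha (hw j)) (mul_nonneg hb (hu j))
        · simp_rw [add_smul, mul_smul, Finset.sum_add_distrib, Finset.smul_sum]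
        · rw [Finset.sum_add_distrib, ← Finset.mul_sum, ← Finset.mul_sum, hw1, hu1]
          linarith
    · rintro ⟨w, hw, hx, hw1⟩
      exact mem_convexHull_of_exists_fintype w v hw hw1 (fun j => ⟨j, rfl⟩) hx
  rw [hx, hf, Set.mem_ofPred_eq]
  exact forall_congr' fun i => by rw [hval, hrow]; constructor <;> intro h <;> linarith

/-! ### Slack matrices -/

/-- Adding valid inequalities and points of `P` to a slack matrix. -/
lemma IsSlackMatrix.exists_extend {d ι κ ι' κ' : Type*} [Fintype d] {P : Set (d → ℝ)}
    {M : Matrix ι κ ℝ} (hM : IsSlackMatrix P M) (A' : Matrix ι' d ℝ) (b' : ι' → ℝ)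
    (v' : κ' → d → ℝ) (hA : ∀ x ∈ P, ∀ i, (A' *ᵥ x) i ≤ b' i) (hv : ∀ j, v' j ∈ P) :
    ∃ M' : Matrix (ι ⊕ ι') (κ ⊕ κ') ℝ, IsSlackMatrix P M' ∧ M'.toBlocks₁₁ = M ∧
      M'.toBlocks₂₂ = Matrix.of fun i j => b' i - (A' *ᵥ v' j) i := by
  obtain ⟨A, b, v, hP, hPv, hMe⟩ := hM
  have hconv : Convex ℝ P := hPv ▸ convex_convexHull ℝ _
  refine ⟨Matrix.of fun i j => Sum.elim b b' i - (Matrix.of (Sum.elim A A') *ᵥ Sum.elim v v' j) i,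
    ⟨Matrix.of (Sum.elim A A'), Sum.elim b b', Sum.elim v v', ?_, ?_, fun i j => rfl⟩, ?_, ?_⟩
  · ext x
    simp only [Set.mem_ofPred_eq, Sum.forall]
    constructor
    · intro hx
      refine ⟨fun i => ?_, fun i => hA x hx i⟩
      rw [hP] at hx
      exact hx i
    · rintro ⟨h, -⟩
      rw [hP]
      exact h
  · refine subset_antisymm ?_ (convexHull_min ?_ hconv)
    · nth_rewrite 1 [hPv]
      refine convexHull_mono ?_
      rintro _ ⟨j, rfl⟩
      exact ⟨Sum.inl j, rfl⟩
    · rintro _ ⟨j | j, rfl⟩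
      · rw [hPv]
        exact subset_convexHull ℝ _ ⟨j, rfl⟩
      · exact hv j
  · ext i j
    exact (hMe i j).symm
  · rfl

/-! ### The matrix `M*` as a submatrix of slack matrices -/

/-- The set with characteristic vector `a`. -/
def support {m : ℕ} (a : Fin m → Fin 2) : Finset (Fin m) := Finset.univ.filter (a · = 1)

lemma MStar_apply {m : ℕ} (a b : Fin m → Fin 2) :
    MStar m a b = (((support b ∩ support a).card : ℝ) - 1) ^ 2 := by
  have h : ∀ u v : Fin 2, ((u : ℕ) : ℝ) * ((v : ℕ) : ℝ) = if v = 1 ∧ u = 1 then 1 else 0 := by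
    intro u v
    fin_cases u <;> fin_cases v <;> simp
  simp only [MStar, Matrix.of_apply, h, support, ← Finset.filter_and, Finset.sum_boole]

lemma IsSlackMatrix.exists_extend_MStar {m : ℕ} {ι κ : Type*} {P : Set (Edge (m + 1) → ℝ)}
    {M : Matrix ι κ ℝ} (hM : IsSlackMatrix P M) (hcut : cutPolytope (m + 1) ⊆ P)
    (hval : ∀ T : Finset (Fin m), ∀ x ∈ P, 0 ≤ hypSlack (bVecOf T) x) :
    ∃ M' : Matrix (ι ⊕ (Fin m → Fin 2)) (κ ⊕ (Fin m → Fin 2)) ℝ,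
      IsSlackMatrix P M' ∧ M'.toBlocks₁₁ = M ∧ M'.toBlocks₂₂ = MStar m := by
  let A' : Matrix (Fin m → Fin 2) (Edge (m + 1)) ℝ := Matrix.of fun a e =>
    (bVecOf (support a) e.1.1 : ℝ) * (bVecOf (support a) e.1.2 : ℝ)
  let b' : (Fin m → Fin 2) → ℝ := fun a => ⌊((∑ i, bVecOf (support a) i : ℤ) : ℝ) ^ 2 / 4⌋
  have hslack : ∀ a x, b' a - (A' *ᵥ x) a = hypSlack (bVecOf (support a)) x := fun _ _ => rfl
  obtain ⟨M', h1, h2, h3⟩ := hM.exists_extend A' b'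
    (fun a => cutVector ((support a).map Fin.castSuccEmb))
    (fun x hx a => sub_nonneg.mp (by rw [hslack]; exact hval _ x hx))
    (fun a => hcut (cutVector_mem_cutPolytope _))
  refine ⟨M', h1, h2, h3.trans ?_⟩
  ext a b
  rw [Matrix.of_apply, hslack, hypSlack_bVecOf_cutVector, MStar_apply]

lemma isSubmatrix_of_toBlocks₂₂ {ι κ ι' κ' : Type*} {M : Matrix (ι ⊕ ι') (κ ⊕ κ') ℝ}
    {N : Matrix ι' κ' ℝ} (h : M.toBlocks₂₂ = N) : IsSubmatrix N M :=
  ⟨Sum.inr, Sum.inr, Sum.inr_injective, Sum.inr_injective, h⟩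

lemma exists_finite_slackMatrix_cutPolytope (n : ℕ) :
    ∃ (ι κ : Type) (_ : Finite ι) (_ : Finite κ) (M : Matrix ι κ ℝ),
      IsSlackMatrix (cutPolytope n) M := by
  obtain ⟨N, hN, A, b, h⟩ := exists_finite_system_convexHull
    (fun S : Finset (Fin n) => (cutVector S : Edge n → ℝ))
  exact ⟨N, Finset (Fin n), hN, inferInstance, _, A, b, cutVector, h, rfl, fun _ _ => rfl⟩

/-- All hypermetric inequalities serve as rows and all points of the set as columns, so nothing
about finiteness or vertices is needed. -/
lemma exists_slackMatrix_hypermetricPolytope (n : ℕ) :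
    ∃ (ι κ : Type) (M : Matrix ι κ ℝ), IsSlackMatrix (hypermetricPolytope n) M := by
  refine ⟨{b : Fin n → ℤ // IsHypermetric b}, hypermetricPolytope n, _,
    Matrix.of fun b e => (b.1 e.1.1 : ℝ) * (b.1 e.1.2 : ℝ),
    fun b => ⌊((∑ i, b.1 i : ℤ) : ℝ) ^ 2 / 4⌋, Subtype.val, ?_, ?_, fun _ _ => rfl⟩
  · ext x
    simp only [hypermetricPolytope, Set.mem_ofPred_eq, Subtype.forall]
    exact forall₂_congr fun b _ => sub_nonneg
  · rw [Subtype.range_coe, (convex_hypermetricPolytope n).convexHull_eq]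

/-! ### Lower bounds on extended formulations -/

lemma hypSlack_smul_add_smul {n : ℕ} (b : Fin n → ℤ) (x y : Edge n → ℝ) {s t : ℝ}
    (hst : s + t = 1) :
    hypSlack b (s • x + t • y) = s * hypSlack b x + t * hypSlack b y := by
  simp only [hypSlack_eq, map_add, map_smul, smul_eq_mul]
  linear_combination (-(⌊((∑ i, b i : ℤ) : ℝ) ^ 2 / 4⌋ : ℝ)) * hst

lemma hypSlack_bVecOf_cutVector_singleton {m : ℕ} {T : Finset (Fin m)} {t : Fin m} (ht : t ∈ T) :
    hypSlack (bVecOf T) (cutVector (({t} : Finset (Fin m)).map Fin.castSuccEmb)) = 0 := by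
  rw [hypSlack_bVecOf_cutVector, Finset.singleton_inter_of_mem ht]
  simp

lemma hypSlack_bVecOf_cutVector_of_disjoint {m : ℕ} {T S : Finset (Fin m)} (h : Disjoint T S) :
    hypSlack (bVecOf T) (cutVector (S.map Fin.castSuccEmb)) = 1 := by
  rw [hypSlack_bVecOf_cutVector, Finset.inter_comm, Finset.disjoint_iff_inter_eq_empty.mp h]
  simp

/-- A family of rectangles that covers the positive slacks but no zero slack is large. -/
lemma three_pow_le_of_slack_cover {m : ℕ} {ι : Type*} [Fintype ι]
    (𝒜 ℬ : ι → Set (Finset (Fin m)))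
    (hne : ∀ i, ∀ T ∈ 𝒜 i, ∀ S ∈ ℬ i,
      hypSlack (bVecOf T) (cutVector (S.map Fin.castSuccEmb)) ≠ 0)
    (hcover : ∀ T S : Finset (Fin m), T.Nonempty → Disjoint T S → ∃ i, T ∈ 𝒜 i ∧ S ∈ ℬ i) :
    3 ^ m ≤ (Fintype.card ι + 1) * 2 ^ m := by
  refine three_pow_le_of_rectangle_cover 𝒜 ℬ (fun i T hT S hS hcard => hne i T hT S hS ?_) hcover
  rw [hypSlack_bVecOf_cutVector, Finset.inter_comm, hcard]
  simp

/-- Rectangle i pairs the T for which y_i vanishes on every lift of the face of T with the S whose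
chosen lift has y_i > 0; slack 0 would contradict this. If a disjoint pair (T, S) is uncovered, some
lift of a point in the face of T is positive wherever the lift of S is. The segment from the lift of
S can then be prolonged beyond that point, where the slack becomes negative. -/
lemma HasExtendedFormulation.three_pow_le {m r : ℕ} {P : Set (Edge (m + 1) → ℝ)}
    (hP : HasExtendedFormulation P r) (hcut : cutPolytope (m + 1) ⊆ P)
    (hval : ∀ T : Finset (Fin m), ∀ x ∈ P, 0 ≤ hypSlack (bVecOf T) x) :
    3 ^ m ≤ (r + 1) * 2 ^ m := by
  obtain ⟨k, E, F, g, hEF⟩ := hP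
  let G : (Edge (m + 1) → ℝ) → (Fin r → ℝ) → Prop := fun x y =>
    (∀ i, 0 ≤ y i) ∧ E *ᵥ x + F *ᵥ y = g
  have hcomb : ∀ (x x' : Edge (m + 1) → ℝ) (y y' : Fin r → ℝ) (s t : ℝ), s + t = 1 →
      E *ᵥ x + F *ᵥ y = g → E *ᵥ x' + F *ᵥ y' = g →
      E *ᵥ (s • x + t • x') + F *ᵥ (s • y + t • y') = g := by
    intro x x' y y' s t hst h h'
    calc E *ᵥ (s • x + t • x') + F *ᵥ (s • y + t • y')
        = s • (E *ᵥ x + F *ᵥ y) + t • (E *ᵥ x' + F *ᵥ y') := by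
          simp only [Matrix.mulVec_add, Matrix.mulVec_smul, smul_add]
          abel
      _ = g := by rw [h, h', ← add_smul, hst, one_smul]
  have hlift : ∀ S : Finset (Fin m), ∃ y, G (cutVector (S.map Fin.castSuccEmb)) y := fun S =>
    (hEF _).mp (hcut (cutVector_mem_cutPolytope _))
  choose Y hY using hlift
  rw [← Fintype.card_fin r]
  refine three_pow_le_of_slack_cover
    (fun i => {T | ∀ x y, G x y → hypSlack (bVecOf T) x = 0 → y i = 0})
    (fun i => {S | 0 < Y S i}) (fun i T hT S hS h0 => hS.ne' (hT _ _ (hY S) h0)) ?_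
  intro T S hT hTS
  by_contra! hcon
  -- a point of the face of `T` whose lift is positive wherever the lift of `S` is
  have hface : ∀ s : Finset (Fin r), ∃ x y, G x y ∧ hypSlack (bVecOf T) x = 0 ∧
      ∀ i ∈ s, 0 < Y S i → 0 < y i := by
    intro s
    induction s using Finset.induction_on with
    | empty =>
      obtain ⟨t, ht⟩ := hT
      exact ⟨_, _, hY {t}, hypSlack_bVecOf_cutVector_singleton ht, by simp⟩
    | insert j s _ ih =>
      obtain ⟨x, y, hxy, hx, hy⟩ := ih
      by_cases hj : 0 < Y S j
      · have hTj : ¬ ∀ x y, G x y → hypSlack (bVecOf T) x = 0 → y j = 0 := fun h => hcon j h hj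
        push Not at hTj
        obtain ⟨x', y', hxy', hx', hy'⟩ := hTj
        -- A midpoint stays over the face and is positive wherever either lift is.
        refine ⟨(1 / 2 : ℝ) • x + (1 / 2 : ℝ) • x', (1 / 2 : ℝ) • y + (1 / 2 : ℝ) • y',
          ⟨fun i => ?_, hcomb _ _ _ _ _ _ (by norm_num) hxy.2 hxy'.2⟩, ?_, fun i hi hSi => ?_⟩
        · have h1 := hxy.1 i
          have h2 := hxy'.1 i
          simp only [Pi.add_apply, Pi.smul_apply, smul_eq_mul]
          linarith
        · rw [hypSlack_smul_add_smul _ _ _ (by norm_num), hx, hx']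
          norm_num
        · have h1 := hxy.1 i
          have h2 := hxy'.1 i
          simp only [Pi.add_apply, Pi.smul_apply, smul_eq_mul]
          rcases Finset.mem_insert.mp hi with rfl | hi
          · have h3 := lt_of_le_of_ne h2 hy'.symm
            linarith
          · have h3 := hy i hi hSi
            linarith
      · refine ⟨x, y, hxy, hx, fun i hi hSi => ?_⟩
        rcases Finset.mem_insert.mp hi with rfl | hi
        · exact absurd hSi hj
        · exact hy i hi hSi
  obtain ⟨x, y, hxy, hx, hy⟩ := hface Finset.univ
  have hstep : ∀ s : Finset (Fin r), ∃ ε : ℝ, 0 < ε ∧ ∀ i ∈ s, ε * Y S i ≤ y i := by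
    intro s
    induction s using Finset.induction_on with
    | empty => exact ⟨1, one_pos, by simp⟩
    | insert j s _ ih =>
      obtain ⟨ε, hε, h⟩ := ih
      have hmin : ∀ δ : ℝ, 0 < δ → δ * Y S j ≤ y j →
          ∃ ε : ℝ, 0 < ε ∧ ∀ i ∈ insert j s, ε * Y S i ≤ y i := by
        refine fun δ hδ hδj => ⟨min ε δ, lt_min hε hδ, fun i hi => ?_⟩
        rcases Finset.mem_insert.mp hi with rfl | hi
        · exact (mul_le_mul_of_nonneg_right (min_le_right _ _) ((hY S).1 i)).trans hδj
        · exact (mul_le_mul_of_nonneg_right (min_le_left _ _) ((hY S).1 i)).trans (h i hi)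
      rcases ((hY S).1 j).eq_or_lt with hj | hj
      · exact hmin 1 one_pos (by rw [← hj, mul_zero]; exact hxy.1 j)
      · exact hmin (y j / Y S j) (div_pos (hy j (Finset.mem_univ _) hj) hj)
          (div_mul_cancel₀ _ hj.ne').le
  obtain ⟨ε, hε, hεy⟩ := hstep Finset.univ
  -- moving from the lift of `S` through this point leaves the half-space of `T`
  have hmem : (1 + ε) • x + (-ε) • cutVector (S.map Fin.castSuccEmb) ∈ P := by
    refine (hEF _).mpr ⟨(1 + ε) • y + (-ε) • Y S, fun i => ?_,
      hcomb _ _ _ _ _ _ (by ring) hxy.2 (hY S).2⟩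
    have h1 := hεy i (Finset.mem_univ _)
    have h2 := mul_nonneg hε.le (hxy.1 i)
    simp only [Pi.add_apply, Pi.smul_apply, smul_eq_mul]
    linarith
  have hneg := hval T _ hmem
  rw [hypSlack_smul_add_smul _ _ _ (by ring), hx, hypSlack_bVecOf_cutVector_of_disjoint hTS] at hneg
  linarith

/-- Rectangle F pairs the T whose face has its preimage inside F with the S whose chosen lift is
outside F. For disjoint T and S the lift of S is off the preimage of the face of T, and some facet
separates the two. The face is nonempty because it contains the cut of {t} with t ∈ T. -/
lemma three_pow_le_ncard_facets {m e : ℕ} {P : Set (Edge (m + 1) → ℝ)} {Q : Set (Fin e → ℝ)}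
    (hQ : IsPolytope Q) (hfin : (facets Q).Finite) (π : (Fin e → ℝ) →ₗ[ℝ] (Edge (m + 1) → ℝ))
    (hπ : π '' Q = P) (hcut : cutPolytope (m + 1) ⊆ P)
    (hval : ∀ T : Finset (Fin m), ∀ x ∈ P, 0 ≤ hypSlack (bVecOf T) x) :
    3 ^ m ≤ ((facets Q).ncard + 1) * 2 ^ m := by
  have hlift : ∀ S : Finset (Fin m), ∃ q ∈ Q, π q = cutVector (S.map Fin.castSuccEmb) := by
    intro S
    have h := hcut (cutVector_mem_cutPolytope (S.map Fin.castSuccEmb))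
    rwa [← hπ] at h
  choose q hqQ hq using hlift
  have := hfin.fintype
  rw [← Nat.card_coe_set_eq, Nat.card_eq_fintype_card]
  refine three_pow_le_of_slack_cover
    (fun F : facets Q => {T | ∀ x ∈ Q, hypSlack (bVecOf T) (π x) = 0 → x ∈ F.1})
    (fun F => {S | q S ∉ F.1})
    (fun F T hT S hS h0 => hS (hT _ (hqQ S) (by rw [hq]; exact h0))) ?_
  rintro T S ⟨t, ht⟩ hTS
  have h0 := hypSlack_bVecOf_cutVector_singleton ht
  have h1 := hypSlack_bVecOf_cutVector_of_disjoint hTS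
  rw [← hq, hypSlack_eq] at h0 h1
  obtain ⟨F, hF, hsub, hqF⟩ := exists_mem_facets hQ (hqQ {t}) (hqQ S) (hypForm (bVecOf T) ∘ₗ π)
    (fun y hy => by
      have := hval T (π y) (hπ ▸ ⟨y, hy, rfl⟩)
      rw [hypSlack_eq] at this
      simp only [LinearMap.comp_apply]
      linarith)
    (by simp only [LinearMap.comp_apply]; linarith)
  refine ⟨⟨F, hF⟩, fun x hx hx0 => hsub ⟨hx, ?_⟩, hqF⟩
  rw [hypSlack_eq] at hx0
  simp only [LinearMap.comp_apply]
  linarith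

lemma two_rpow_le_of_three_pow_le {m r : ℕ} (hm : 4 ≤ m) (h : 3 ^ m ≤ (r + 1) * 2 ^ m) :
    (2 : ℝ) ^ ((1 / 4 : ℝ) * ((m + 1 : ℕ) : ℝ)) ≤ r := by
  have h1 : (3 / 2 : ℝ) ^ m ≤ r + 1 := by
    rw [div_pow, div_le_iff₀ (by positivity)]
    exact_mod_cast h
  -- Any base strictly between 1 and 3/2 would eventually absorb the + 1 and the shift from m to m +
  -- 1; 5/4 does so from m = 4 on, and (5/4)⁴ ≥ 2 gives the exponent 1/4.
  have h2 : (5 / 4 : ℝ) ^ (m + 1) + 1 ≤ (3 / 2 : ℝ) ^ m := by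
    clear h h1
    induction m, hm using Nat.le_induction with
    | base => norm_num
    | succ m _ ih =>
      rw [pow_succ, pow_succ (3 / 2 : ℝ)]
      have : (0 : ℝ) < (5 / 4) ^ (m + 1) := by positivity
      linarith
  have h3 : (2 : ℝ) ^ (1 / 4 : ℝ) ≤ 5 / 4 := by
    calc (2 : ℝ) ^ (1 / 4 : ℝ) ≤ ((5 / 4 : ℝ) ^ 4) ^ (((4 : ℕ) : ℝ)⁻¹) := by
          rw [one_div]
          exact Real.rpow_le_rpow (by norm_num) (by norm_num) (by norm_num)
      _ = 5 / 4 := Real.pow_rpow_inv_natCast (by norm_num) (by norm_num)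
  calc (2 : ℝ) ^ ((1 / 4 : ℝ) * ((m + 1 : ℕ) : ℝ)) = ((2 : ℝ) ^ (1 / 4 : ℝ)) ^ (m + 1) := by
        rw [Real.rpow_mul (by norm_num), Real.rpow_natCast]
    _ ≤ (5 / 4) ^ (m + 1) := pow_le_pow_left₀ (by positivity) h3 _
    _ ≤ r := by linarith

lemma two_rpow_le_extensionComplexity {m : ℕ} (hm : 4 ≤ m) {P : Set (Edge (m + 1) → ℝ)}
    (hcut : cutPolytope (m + 1) ⊆ P)
    (hval : ∀ T : Finset (Fin m), ∀ x ∈ P, 0 ≤ hypSlack (bVecOf T) x) :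
    (2 : ℝ≥0∞) ^ ((1 / 4 : ℝ) * ((m + 1 : ℕ) : ℝ)) ≤ ((extensionComplexity P : ℕ∞) : ℝ≥0∞) := by
  set B : ℕ := ⌈(2 : ℝ) ^ ((1 / 4 : ℝ) * ((m + 1 : ℕ) : ℝ))⌉₊ with hB
  have hle : (B : ℕ∞) ≤ extensionComplexity P := by
    refine le_iInf fun e => le_iInf fun Q => le_iInf fun hQ => le_iInf fun π => le_iInf fun hπ => ?_
    -- With infinitely many facets the count is ⊤ and the bound trivial, so finiteness need not be
    -- proved.
    rcases (facets Q).finite_or_infinite with hfin | hinf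
    · rw [← hfin.cast_ncard_eq, Nat.cast_le, hB, Nat.ceil_le]
      exact two_rpow_le_of_three_pow_le hm (three_pow_le_ncard_facets hQ hfin π hπ hcut hval)
    · rw [hinf.encard_eq]
      exact le_top
  calc (2 : ℝ≥0∞) ^ ((1 / 4 : ℝ) * ((m + 1 : ℕ) : ℝ))
      = ENNReal.ofReal ((2 : ℝ) ^ ((1 / 4 : ℝ) * ((m + 1 : ℕ) : ℝ))) := by
        rw [← ENNReal.ofReal_rpow_of_pos two_pos, ENNReal.ofReal_ofNat]
    _ ≤ ENNReal.ofReal B := ENNReal.ofReal_le_ofReal (Nat.le_ceil _)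
    _ = ((B : ℕ∞) : ℝ≥0∞) := by simp
    _ ≤ _ := ENat.toENNReal_le.mpr hle

end CutXC

theorem mainTheorem3 :
    -- Part 1: for `n = m + 1 ≥ 2`, the inequality of `b = (1, …, 1, 3 - n)` and its slack
    (∀ m : ℕ, 1 ≤ m →
      CutXC.IsNegativeType (CutXC.bVec m) ∧
      (∀ x : CutXC.Edge (m + 1) → ℝ,
        CutXC.hypSlack (CutXC.bVec m) x =
          1 + (((m + 1 : ℕ) : ℝ) - 3) *
              ∑ i : Fin m, x ⟨(i.castSucc, Fin.last m), Fin.castSucc_lt_last i⟩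
            - ∑ e : CutXC.Edge m,
                x ⟨(e.1.1.castSucc, e.1.2.castSucc), Fin.castSucc_lt_castSucc_iff.mpr e.2⟩) ∧
      (∀ S : Finset (Fin (m + 1)), Fin.last m ∉ S →
        CutXC.hypSlack (CutXC.bVec m) (CutXC.cutVector S) = ((S.card : ℝ) - 1) ^ 2)) ∧
    -- Part 2: the rows and columns of the matrix `M`
    (∀ m : ℕ, 1 ≤ m → ∀ T : Finset (Fin m),
      (T.Nonempty → CutXC.IsNegativeType (CutXC.bVecOf T)) ∧
      (∀ x ∈ CutXC.cutPolytope (m + 1), 0 ≤ CutXC.hypSlack (CutXC.bVecOf T) x) ∧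
      (∀ x ∈ CutXC.hypermetricPolytope (m + 1), 0 ≤ CutXC.hypSlack (CutXC.bVecOf T) x) ∧
      (∀ S : Finset (Fin m),
        CutXC.hypSlack (CutXC.bVecOf T) (CutXC.cutVector (S.map Fin.castSuccEmb)) =
          (((S ∩ T).card : ℝ) - 1) ^ 2)) ∧
    -- Part 3: the cut polytope is contained in the hypermetric polytope, and inequalities of
    -- negative type are valid for both
    (∀ n : ℕ, 2 ≤ n →
      CutXC.cutPolytope n ⊆ CutXC.hypermetricPolytope n ∧
      ∀ b : Fin n → ℤ, CutXC.IsNegativeType b →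
        ∀ x ∈ CutXC.hypermetricPolytope n, 0 ≤ CutXC.hypSlack b x) ∧
    -- Part 4: `M*(n - 1)` is a submatrix of a (finite) slack matrix of the cut polytope
    (∀ m : ℕ, 1 ≤ m →
      ∃ (ι κ : Type) (_ : Finite ι) (_ : Finite κ) (M : Matrix ι κ ℝ),
        CutXC.IsSlackMatrix (CutXC.cutPolytope (m + 1)) M ∧
        CutXC.IsSubmatrix (CutXC.MStar m) M) ∧
    -- Part 5: `M*(n - 1)` is a submatrix of a slack matrix of the hypermetric polytope; every
    -- slack matrix becomes such a one by adding `2 ^ (n - 1)` rows and columns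
    (∀ m : ℕ, 1 ≤ m →
      (∃ (ι κ : Type) (M : Matrix ι κ ℝ),
        CutXC.IsSlackMatrix (CutXC.hypermetricPolytope (m + 1)) M ∧
        CutXC.IsSubmatrix (CutXC.MStar m) M) ∧
      (∀ (ι κ : Type) (M : Matrix ι κ ℝ),
        CutXC.IsSlackMatrix (CutXC.hypermetricPolytope (m + 1)) M →
        ∃ M' : Matrix (ι ⊕ (Fin m → Fin 2)) (κ ⊕ (Fin m → Fin 2)) ℝ,
          CutXC.IsSlackMatrix (CutXC.hypermetricPolytope (m + 1)) M' ∧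
          M'.toBlocks₁₁ = M ∧ M'.toBlocks₂₂ = CutXC.MStar m)) ∧
    -- Part 6: every extended formulation has size `2 ^ Ω(n)`, and the extension complexity
    -- is `2 ^ Ω(n)`, for the cut polytope and for the hypermetric polytope
    (∃ c : ℝ, 0 < c ∧ ∃ N : ℕ, ∀ n : ℕ, N ≤ n →
      (∀ r : ℕ, CutXC.HasExtendedFormulation (CutXC.cutPolytope n) r →
        (2 : ℝ) ^ (c * (n : ℝ)) ≤ (r : ℝ)) ∧
      (2 : ℝ≥0∞) ^ (c * (n : ℝ)) ≤
        ((CutXC.extensionComplexity (CutXC.cutPolytope n) : ℕ∞) : ℝ≥0∞) ∧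
      (∀ r : ℕ, CutXC.HasExtendedFormulation (CutXC.hypermetricPolytope n) r →
        (2 : ℝ) ^ (c * (n : ℝ)) ≤ (r : ℝ)) ∧
      (2 : ℝ≥0∞) ^ (c * (n : ℝ)) ≤
        ((CutXC.extensionComplexity (CutXC.hypermetricPolytope n) : ℕ∞) : ℝ≥0∞)) := by
  refine ⟨fun m hm => ⟨CutXC.isNegativeType_bVec hm, CutXC.hypSlack_bVec m, fun S hS => ?_⟩,
    fun m _ T => ⟨CutXC.isNegativeType_bVecOf,
      fun x hx => CutXC.hypSlack_nonneg_of_mem_cutPolytope _ hx,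
      fun x hx => CutXC.hypSlack_bVecOf_nonneg T hx,
      CutXC.hypSlack_bVecOf_cutVector T⟩,
    fun n hn => ⟨CutXC.cutPolytope_subset_hypermetricPolytope n,
      fun b hb x hx => hb.hypSlack_nonneg (by omega) hx⟩,
    fun m _ => ?_, fun m _ => ⟨?_, fun ι κ M hM => hM.exists_extend_MStar
      (CutXC.cutPolytope_subset_hypermetricPolytope _)
      fun T x hx => CutXC.hypSlack_bVecOf_nonneg T hx⟩,
    1 / 4, by norm_num, 5, fun n hn => ?_⟩
  · rw [CutXC.hypSlack_cutVector_of_sum_eq_two (CutXC.sum_bVec m),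
      CutXC.sum_bVec_of_last_notMem hS]
  · obtain ⟨ι, κ, _, _, M, hM⟩ := CutXC.exists_finite_slackMatrix_cutPolytope (m + 1)
    obtain ⟨M', h1, _, h3⟩ := hM.exists_extend_MStar subset_rfl
      fun T x hx => CutXC.hypSlack_nonneg_of_mem_cutPolytope _ hx
    exact ⟨_, _, inferInstance, inferInstance, M', h1, CutXC.isSubmatrix_of_toBlocks₂₂ h3⟩
  · obtain ⟨ι, κ, M, hM⟩ := CutXC.exists_slackMatrix_hypermetricPolytope (m + 1)
    obtain ⟨M', h1, _, h3⟩ := hM.exists_extend_MStar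
      (CutXC.cutPolytope_subset_hypermetricPolytope _)
      fun T x hx => CutXC.hypSlack_bVecOf_nonneg T hx
    exact ⟨_, _, M', h1, CutXC.isSubmatrix_of_toBlocks₂₂ h3⟩
  · obtain ⟨m, rfl⟩ : ∃ m, n = m + 1 := ⟨n - 1, by omega⟩
    have hm : 4 ≤ m := by omega
    have hcut := CutXC.cutPolytope_subset_hypermetricPolytope (m + 1)
    have hvalC : ∀ T : Finset (Fin m), ∀ x ∈ CutXC.cutPolytope (m + 1),
        0 ≤ CutXC.hypSlack (CutXC.bVecOf T) x :=
      fun T x hx => CutXC.hypSlack_nonneg_of_mem_cutPolytope _ hx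
    have hvalH : ∀ T : Finset (Fin m), ∀ x ∈ CutXC.hypermetricPolytope (m + 1),
        0 ≤ CutXC.hypSlack (CutXC.bVecOf T) x :=
      fun T x hx => CutXC.hypSlack_bVecOf_nonneg T hx
    exact ⟨fun r hr => CutXC.two_rpow_le_of_three_pow_le hm (hr.three_pow_le subset_rfl hvalC),
      CutXC.two_rpow_le_extensionComplexity hm subset_rfl hvalC,
      fun r hr => CutXC.two_rpow_le_of_three_pow_le hm (hr.three_pow_le hcut hvalH),
      CutXC.two_rpow_le_extensionComplexity hm hcut hvalH⟩
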